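/- Let $k$ be an algebraically closed field of characteristic $0$, let $d\ge 1$, $n\ge 1$, and let $X\subset\mathbb P^2=\mathbb P^2_k$ be a set of $\binom{d+1}{2}$ points in generic position, i.e. whose Hilbert function is $H_X(t)=\min\{\binom{d+1}{2},\binom{t+2}{2}\}$ for all $t\ge 0$. Let $I_X\subset k[w_1,w_2,w_3]$ be the defining ideal of $X$ and let $L=(L_{lj})$ be a $d\times(d+1)$ matrix of linear forms $L_{lj}=\sum_{i=1}^3\lambda_{lji}w_i$ (a Hilbert--Burch matrix of $X$) such that $I_X=(F_1,\dots,F_{d+1})$, where $F_j=(-1)^{j+1}\det(L\setminus j\text{-th column})$. Let $u=\binom{n+2}{2}$ and $p=u(d+1)-1$, and use homogeneous coordinates $x_{\alpha j}$ on $\mathbb P^p$, where $\alpha\in\mathbb Z_{\ge0}^3$, $|\alpha|=n$ and $1\le j\le d+1$. Let $\varphi:\mathbb P^2\setminus X\to\mathbb P^p$ be the map $\varphi([w])=[w^\alpha F_j(w)]_{\alpha,j}$; the embedding of the blowup of $\mathbb P^2$ along $X$ by the forms of degree $d+n$ in $I_X$ is the surface $\overline{\varphi(\mathbb P^2\setminus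 X)}$ (Zariski closure in $\mathbb P^p$). Let $V\subset\mathbb P^p$ be the algebraic set defined by 1. the linear equations $\sum_{j=1}^{d+1}\sum_{i=1}^{3}\lambda_{lji}\,x_{\beta+e_i,\,j}=0$ for all $1\le l\le d$ and all $\beta\in\mathbb Z_{\ge0}^3$ with $|\beta|=n-1$ (where $e_1,e_2,e_3$ are the unit vectors); 2. the $2\times2$ minors of the $u\times(d+1)$ matrix $M=(x_{\alpha j})$; 3. for each $j=1,\dots,d+1$, the $2\times 2$ minors of the $3\times\binom{n+1}{2}$ catalecticant matrix whose entry in row $i$ and column $\beta$ ($|\beta|=n-1$) is $x_{\beta+e_i,\,j}$. Then, as sets, $V=\overline{\varphi(\mathbb P^2\setminus X)}$. -/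

import Mathlib

/-! Projective algebraic sets. Points of projective space are Mathlib's `Projectivization`. -/

namespace BoxBlowup

variable {k : Type*} [Field k] {σ : Type*}

/-- The polynomial `f` vanishes at the point `Q` of the projective space with coordinates indexed by
`σ`, i.e. at every vector of homogeneous coordinates of `Q`. -/
def VanishesAt (f : MvPolynomial σ k) (Q : Projectivization k (σ → k)) : Prop :=
  ∀ (v : σ → k) (hv : v ≠ 0), Projectivization.mk k v hv = Q → MvPolynomial.eval v f = 0

/-- The set of common zeros in projective space of a set of polynomials. -/
def projZeroLocus (S : Set (MvPolynomial σ k)) : Set (Projectivization k (σ → k)) :=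
  {Q | ∀ f ∈ S, VanishesAt f Q}

/-- Zariski closed subsets of projective space: common zeros of a set of forms. -/
def IsZariskiClosed (Z : Set (Projectivization k (σ → k))) : Prop :=
  ∃ S : Set (MvPolynomial σ k), (∀ f ∈ S, ∃ e : ℕ, f.IsHomogeneous e) ∧ Z = projZeroLocus S

/-- The Zariski closure: the intersection of all Zariski closed sets containing `Y`. -/
def zariskiClosure (Y : Set (Projectivization k (σ → k))) : Set (Projectivization k (σ → k)) :=
  ⋂₀ {Z | IsZariskiClosed Z ∧ Y ⊆ Z}

/-- The defining ideal `I_X` of a set `X` of points of projective space. -/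
def vanishingIdeal (X : Set (Projectivization k (σ → k))) : Ideal (MvPolynomial σ k) where
  carrier := {f | ∀ P ∈ X, VanishesAt f P}
  add_mem' := by
    intro f g hf hg P hP v hv hvP
    rw [map_add, hf P hP v hv hvP, hg P hP v hv hvP, add_zero]
  zero_mem' := by
    intro P _ v _ _
    exact map_zero _
  smul_mem' := by
    intro c f hf P hP v hv hvP
    rw [smul_eq_mul, map_mul, hf P hP v hv hvP, mul_zero]

/-- The Hilbert function of `X`: the dimension of the degree `t` part of the homogeneous coordinate
ring of `X`, i.e. of the image of the forms of degree `t` in the quotient by `I_X`. -/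
noncomputable def hilbertFunction (X : Set (Projectivization k (σ → k))) (t : ℕ) : ℕ :=
  Module.finrank k
    ((MvPolynomial.homogeneousSubmodule σ k t).map
      (Ideal.Quotient.mkₐ k (vanishingIdeal X)).toLinearMap)

/-- A finite set of points of the projective plane is in generic position if its Hilbert function is
the largest possible one: `min (#X) (dim R_t)` in each degree `t`. -/
def InGenericPosition (X : Finset (Projectivization k (Fin 3 → k))) : Prop :=
  ∀ t : ℕ, hilbertFunction (X : Set (Projectivization k (Fin 3 → k))) t
    = min X.card ((t + 2).choose 2)

/-- The signed maximal minors of a `d × (d+1)` matrix: `F_j` is `(-1)^j` times the determinant of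
the matrix without its column `j` (columns are numbered from `0`). -/
noncomputable def signedMinor {d : ℕ}
    (L : Matrix (Fin d) (Fin (d + 1)) (MvPolynomial (Fin 3) k)) (j : Fin (d + 1)) :
    MvPolynomial (Fin 3) k :=
  (-1) ^ (j : ℕ) * (L.submatrix id j.succAbove).det

/-- `L` is a Hilbert-Burch matrix of `X`: its entries are linear forms and its signed maximal minors
generate the defining ideal of `X`. -/
def IsHilbertBurch {d : ℕ} (X : Set (Projectivization k (Fin 3 → k)))
    (L : Matrix (Fin d) (Fin (d + 1)) (MvPolynomial (Fin 3) k)) : Prop :=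
  (∀ l j, (L l j).IsHomogeneous 1) ∧ vanishingIdeal X = Ideal.span (Set.range (signedMinor L))

/-- Exponents `α` of the monomials `w^α` of degree `n` in three variables; they index the rows of
the matrix `M` of coordinates. -/
abbrev Mon (n : ℕ) : Type := {α : Fin 3 →₀ ℕ // α.degree = n}

/-- Exponents `β` of the monomials of degree `n - 1` (for `n ≥ 1`). -/
abbrev MonPred (n : ℕ) : Type := {β : Fin 3 →₀ ℕ // β.degree + 1 = n}

/-- The exponent of the monomial `w^β w_i`. -/
noncomputable def MonPred.up {n : ℕ} (β : MonPred n) (i : Fin 3) : Mon n :=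
  ⟨β.1 + Finsupp.single i 1, by rw [map_add, Finsupp.degree_single, β.2]⟩

/-- The index set of the homogeneous coordinates `x_{αj}` of the target projective space. -/
abbrev Idx (n d : ℕ) : Type := Mon n × Fin (d + 1)

/-- The vector `(w^α F_j(w))` of homogeneous coordinates of the image of `[w_1 : w_2 : w_3]`. -/
noncomputable def phiCoord {d : ℕ} (n : ℕ)
    (L : Matrix (Fin d) (Fin (d + 1)) (MvPolynomial (Fin 3) k)) (w : Fin 3 → k) :
    Idx n d → k :=
  fun a => MvPolynomial.eval w (MvPolynomial.monomial a.1.1 1 * signedMinor L a.2)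

/-- The image `φ(ℙ² ∖ X)` of the rational map `φ = [w^α F_j]`. -/
def phiImage {d : ℕ} (n : ℕ) (X : Set (Projectivization k (Fin 3 → k)))
    (L : Matrix (Fin d) (Fin (d + 1)) (MvPolynomial (Fin 3) k)) :
    Set (Projectivization k (Idx n d → k)) :=
  {Q | ∃ (w : Fin 3 → k) (hw : w ≠ 0) (h : phiCoord n L w ≠ 0),
    Projectivization.mk k w hw ∉ X ∧ Q = Projectivization.mk k (phiCoord n L w) h}

/-- The embedded blowup surface: the closure of `φ(ℙ² ∖ X)`. -/
def embeddedBlowup {d : ℕ} (n : ℕ) (X : Set (Projectivization k (Fin 3 → k)))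
    (L : Matrix (Fin d) (Fin (d + 1)) (MvPolynomial (Fin 3) k)) :
    Set (Projectivization k (Idx n d → k)) :=
  zariskiClosure (phiImage n X L)

/-- The linear dependence relations, one for each row `l` of `L` and each `β` with `|β| = n - 1`:
substitute `x_{αj}` for `w^α F_j` in `∑_j (w^β L_{lj}) F_j = 0`. The coefficient of `w_i` in
`L_{lj}` is `(L l j).coeff (Finsupp.single i 1)`. -/
def linearRelations {d : ℕ} (n : ℕ)
    (L : Matrix (Fin d) (Fin (d + 1)) (MvPolynomial (Fin 3) k)) :
    Set (MvPolynomial (Idx n d) k) :=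
  {f | ∃ (l : Fin d) (β : MonPred n), f = ∑ j : Fin (d + 1), ∑ i : Fin 3,
    MvPolynomial.C ((L l j).coeff (Finsupp.single i 1)) * MvPolynomial.X (β.up i, j)}

/-- The set of `2 × 2` minors of a matrix (trivial ones allowed). -/
def twoMinors {R m p : Type*} [CommRing R] (A : Matrix m p R) : Set R :=
  {f | ∃ a b : m, ∃ i j : p, f = A a i * A b j - A a j * A b i}

/-- The `u × (d+1)` matrix `M` of the coordinates `x_{αj}`. -/
noncomputable def coordMatrix (k : Type*) [Field k] (n d : ℕ) :
    Matrix (Mon n) (Fin (d + 1)) (MvPolynomial (Idx n d) k) :=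
  Matrix.of fun α j => MvPolynomial.X (α, j)

/-- The catalecticant matrix `Cat(1, n-1; 3)` on the column `j` of `M`: a `3 × (n+1 choose 2)`
matrix whose `(i, β)` entry is the coordinate belonging to the monomial `w_i w^β`. -/
noncomputable def catalecticant (k : Type*) [Field k] (n d : ℕ) (j : Fin (d + 1)) :
    Matrix (Fin 3) (MonPred n) (MvPolynomial (Idx n d) k) :=
  Matrix.of fun i β => coordMatrix k n d (β.up i) j

/-- The algebraic set `V` cut out by the three families of equations. -/
def algSetV {d : ℕ} (n : ℕ) (L : Matrix (Fin d) (Fin (d + 1)) (MvPolynomial (Fin 3) k)) :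
    Set (Projectivization k (Idx n d → k)) :=
  projZeroLocus (linearRelations n L ∪ twoMinors (coordMatrix k n d)
    ∪ ⋃ j : Fin (d + 1), twoMinors (catalecticant k n d j))

end BoxBlowup

/-! The algebraic set `V` is an incidence variety. The `2 × 2` minors of `M` force a point of `V` to
have the form `x_{αj} = a_α b_j`, the catalecticant minors of a column with `b_j ≠ 0` force
`a_α = c w^α` (`exists_eq_veronese`), and the linear relations then say exactly that `L(w) b = 0`
(`exists_eq_segreVeronese`). So `V` is the Segre-Veronese image of the pairs `(w, b)` with
`L(w) b = 0`, and it remains to see that these pairs are limits of the pairs `(w, F(w))`.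

Off `X` some `F_j(w)` is nonzero, so `L(w)` has rank `d` and its kernel is spanned by `F(w)`: the
point is `φ(w)` (`exists_eq_smul_of_mulVec_eq_zero`).

At a point `w` of `X` the key is that the differential of `F = (F_1, …, F_{d+1})` maps onto the
kernel of `L(w)` (`exists_minorsDeriv_eq`). Differentiating `L F = 0` puts its image inside this
kernel. Its rank is at least two, because `I_X` is the full vanishing ideal and hence contains
elements with arbitrary differential at `w` vanishing on `w` (`ker_minorsDeriv_le`). The kernel of
`L(w)` has dimension at most two, because a determinant vanishes to order two where its matrix has
corank two (`finrank_ker_evalMatrix_le_two`). Thus `b` is a directional derivative `∂_v F(w)`, and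
`(w, b)` is the limit of `(w + t v, F(w + t v) / t)` for `t → 0`; algebraically, a form vanishing on
the image of `φ` pulls back to a polynomial in `t` with infinitely many zeros
(`eval_segreVeronese_minorsDeriv`). -/

namespace BoxBlowup

open MvPolynomial

/-! ### Evaluation of forms -/

section Forms

variable {k : Type*} [Field k] {σ : Type*}

lemma aeval_smul_of_isHomogeneous {S : Type*} [CommRing S] [Algebra k S] {f : MvPolynomial σ k}
    {e : ℕ} (hf : f.IsHomogeneous e) (c : S) (x : σ → S) :
    aeval (c • x) f = c ^ e * aeval x f := by
  rw [aeval_def, aeval_def, eval₂_eq, eval₂_eq, Finset.mul_sum]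
  refine Finset.sum_congr rfl fun m hm => ?_
  have hdeg : ∑ i ∈ m.support, m i = e := by
    have := hf (mem_support_iff.mp hm)
    simpa [Finsupp.weight_apply, Finsupp.sum] using this
  simp only [Pi.smul_apply, smul_eq_mul, mul_pow, Finset.prod_mul_distrib,
    Finset.prod_pow_eq_pow_sum, hdeg]
  ring

lemma eval_smul_of_isHomogeneous {f : MvPolynomial σ k} {e : ℕ} (hf : f.IsHomogeneous e) (c : k)
    (x : σ → k) : eval (c • x) f = c ^ e * eval x f := by
  simpa [aeval_eq_eval] using aeval_smul_of_isHomogeneous hf c x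

lemma eval_eq_sum_coeff_of_isHomogeneous_one [Fintype σ] {f : MvPolynomial σ k}
    (hf : f.IsHomogeneous 1) (w : σ → k) :
    eval w f = ∑ i, f.coeff (Finsupp.single i 1) * w i := by
  classical
  have h : f = ∑ i, C (f.coeff (Finsupp.single i 1)) * X i := by
    ext m
    rw [coeff_sum]
    simp only [coeff_C_mul, coeff_X]
    by_cases hm : m.degree = 1
    · obtain ⟨i, rfl⟩ := (Finsupp.sum_eq_one_iff m).mp hm
      simp [Finsupp.single_left_inj]
    · rw [hf.coeff_eq_zero hm, Finset.sum_eq_zero]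
      intro i _
      rw [if_neg, mul_zero]
      rintro rfl
      simp at hm
  conv_lhs => rw [h]
  simp

lemma vanishesAt_mk_iff {f : MvPolynomial σ k} {e : ℕ} (hf : f.IsHomogeneous e) {x : σ → k}
    (hx : x ≠ 0) : VanishesAt f (Projectivization.mk k x hx) ↔ eval x f = 0 := by
  refine ⟨fun h => h x hx rfl, fun h v hv hvx => ?_⟩
  obtain ⟨c, rfl⟩ := (Projectivization.mk_eq_mk_iff' k v x hv hx).mp hvx
  rw [eval_smul_of_isHomogeneous hf, h, mul_zero]

end Forms

/-! ### Hypersurfaces through points of the plane -/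

section Points

variable {k : Type*} [Field k]

/-- The linear form `a_i X_j - a_j X_i`, which vanishes at `a`. -/
noncomputable def lineThrough (a : Fin 3 → k) (i j : Fin 3) : MvPolynomial (Fin 3) k :=
  C (a i) * X j - C (a j) * X i

lemma isHomogeneous_lineThrough (a : Fin 3 → k) (i j : Fin 3) :
    (lineThrough a i j).IsHomogeneous 1 :=
  (isHomogeneous_C_mul_X _ _).sub (isHomogeneous_C_mul_X _ _)

@[simp]
lemma eval_lineThrough (a v : Fin 3 → k) (i j : Fin 3) :
    eval v (lineThrough a i j) = a i * v j - a j * v i := by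
  simp [lineThrough]

lemma mem_span_of_eval_lineThrough {a v : Fin 3 → k} (ha : a ≠ 0)
    (h : ∀ i j, eval v (lineThrough a i j) = 0) : v ∈ Submodule.span k {a} := by
  obtain ⟨i, hi⟩ := Function.ne_iff.mp ha
  rw [Pi.zero_apply] at hi
  refine Submodule.mem_span_singleton.mpr ⟨v i / a i, funext fun j => ?_⟩
  have := h i j
  rw [eval_lineThrough] at this
  rw [Pi.smul_apply, smul_eq_mul]
  field_simp
  linear_combination -this

lemma exists_vanishesAt_eval_ne_zero (P : Projectivization k (Fin 3 → k)) {w : Fin 3 → k}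
    (hw : w ≠ 0) (hP : Projectivization.mk k w hw ≠ P) :
    ∃ f : MvPolynomial (Fin 3) k, VanishesAt f P ∧ eval w f ≠ 0 := by
  induction P using Projectivization.ind with
  | h a ha =>
    by_contra! hcon
    have hmem := mem_span_of_eval_lineThrough (v := w) ha fun i j =>
      hcon _ ((vanishesAt_mk_iff (isHomogeneous_lineThrough a i j) ha).mpr (by
        rw [eval_lineThrough]; ring))
    exact hP ((Projectivization.mk_eq_mk_iff' k w a hw ha).mpr
      (Submodule.mem_span_singleton.mp hmem))

lemma exists_mem_vanishingIdeal_eval_ne_zero (X : Finset (Projectivization k (Fin 3 → k)))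
    {w : Fin 3 → k} (hw : w ≠ 0) (hX : Projectivization.mk k w hw ∉ X) :
    ∃ f ∈ vanishingIdeal (X : Set (Projectivization k (Fin 3 → k))), eval w f ≠ 0 := by
  have h : ∀ P ∈ X, ∃ f : MvPolynomial (Fin 3) k, VanishesAt f P ∧ eval w f ≠ 0 := fun P hP =>
    exists_vanishesAt_eval_ne_zero P hw fun hwP => hX (hwP ▸ hP)
  choose! f hf hfw using h
  refine ⟨∏ P ∈ X, f P, fun P hP v hv hvP => ?_, ?_⟩
  · rw [map_prod]
    exact Finset.prod_eq_zero hP (hf P hP v hv hvP)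
  · rw [map_prod]
    exact Finset.prod_ne_zero_iff.mpr hfw

end Points

/-! ### Restriction to a line and directional derivatives -/

section Line

variable {k : Type*} [Field k]

/-- Restriction of a polynomial to the parametrized line `t ↦ w + t v`. -/
noncomputable def restrictLine (w v : Fin 3 → k) :
    MvPolynomial (Fin 3) k →ₐ[k] Polynomial k :=
  aeval fun i => Polynomial.C (w i) + Polynomial.X * Polynomial.C (v i)

lemma eval_restrictLine (w v : Fin 3 → k) (t : k) (f : MvPolynomial (Fin 3) k) :
    (restrictLine w v f).eval t = eval (w + t • v) f := by
  induction f using MvPolynomial.induction_on with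
  | C a => simp [restrictLine, Polynomial.algebraMap_eq]
  | add p q hp hq => simp [hp, hq]
  | mul_X p i hp =>
    rw [map_mul, Polynomial.eval_mul, hp]
    simp [restrictLine, mul_comm t]

/-- The derivative of `f` at `w`, as a linear function of the direction. -/
noncomputable def dirDeriv (w : Fin 3 → k) (f : MvPolynomial (Fin 3) k) :
    (Fin 3 → k) →ₗ[k] k :=
  ∑ i, eval w (pderiv i f) • LinearMap.proj i

lemma dirDeriv_apply (w v : Fin 3 → k) (f : MvPolynomial (Fin 3) k) :
    dirDeriv w f v = ∑ i, eval w (pderiv i f) * v i := by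
  simp [dirDeriv]

lemma dirDeriv_add (w v : Fin 3 → k) (f g : MvPolynomial (Fin 3) k) :
    dirDeriv w (f + g) v = dirDeriv w f v + dirDeriv w g v := by
  simp [dirDeriv_apply, add_mul, Finset.sum_add_distrib]

lemma dirDeriv_mul (w v : Fin 3 → k) (f g : MvPolynomial (Fin 3) k) :
    dirDeriv w (f * g) v = eval w f * dirDeriv w g v + dirDeriv w f v * eval w g := by
  simp only [dirDeriv_apply, Derivation.leibniz, smul_eq_mul, map_add, map_mul, Finset.mul_sum,
    Finset.sum_mul, ← Finset.sum_add_distrib]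
  exact Finset.sum_congr rfl fun i _ => by ring

lemma dirDeriv_X (w v : Fin 3 → k) (i : Fin 3) : dirDeriv w (X i) v = v i := by
  simp [dirDeriv_apply, pderiv_X, Pi.single_apply, apply_ite]

lemma dirDeriv_C (w v : Fin 3 → k) (a : k) : dirDeriv w (C a) v = 0 := by
  simp [dirDeriv_apply]

lemma dirDeriv_lineThrough (w v a : Fin 3 → k) (i j : Fin 3) :
    dirDeriv w (lineThrough a i j) v = eval v (lineThrough a i j) := by
  rw [lineThrough, sub_eq_add_neg, ← neg_mul, ← C_neg, dirDeriv_add, dirDeriv_mul, dirDeriv_mul]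
  simp only [dirDeriv_C, dirDeriv_X, eval_C, zero_mul, add_zero, map_add, map_mul, eval_X]

lemma coeff_one_restrictLine (w v : Fin 3 → k) (f : MvPolynomial (Fin 3) k) :
    (restrictLine w v f).coeff 1 = dirDeriv w f v := by
  induction f using MvPolynomial.induction_on with
  | C a => simp [restrictLine, Polynomial.algebraMap_eq, dirDeriv_C]
  | add p q hp hq => simp [hp, hq, dirDeriv_add]
  | mul_X p i hp =>
    have h0 : (restrictLine w v p).coeff 0 = eval w p := by
      rw [Polynomial.coeff_zero_eq_eval_zero, eval_restrictLine, zero_smul, add_zero]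
    rw [map_mul, Polynomial.mul_coeff_one, h0, hp, dirDeriv_mul, dirDeriv_X]
    simp [restrictLine]

lemma exists_restrictLine_eq_X_mul {w : Fin 3 → k} (v : Fin 3 → k) {f : MvPolynomial (Fin 3) k}
    (hf : eval w f = 0) :
    ∃ g : Polynomial k, restrictLine w v f = Polynomial.X * g ∧ g.eval 0 = dirDeriv w f v := by
  have h0 : (restrictLine w v f).coeff 0 = 0 := by
    rw [Polynomial.coeff_zero_eq_eval_zero, eval_restrictLine, zero_smul, add_zero, hf]
  obtain ⟨g, hg⟩ := Polynomial.X_dvd_iff.mpr h0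
  refine ⟨g, hg, ?_⟩
  rw [← coeff_one_restrictLine, hg, ← Polynomial.coeff_zero_eq_eval_zero]
  exact (Polynomial.coeff_X_mul g 0).symm

end Line

/-! ### Matrices with one more column than rows -/

section Minors

open Matrix

/-- Expansion of a determinant with a repeated row. -/
lemma sum_mul_det_submatrix_succAbove {R : Type*} [CommRing R] {d : ℕ}
    (A : Matrix (Fin d) (Fin (d + 1)) R) (l : Fin d) :
    ∑ j : Fin (d + 1), A l j * ((-1) ^ (j : ℕ) * (A.submatrix id j.succAbove).det) = 0 := by
  let B : Matrix (Fin (d + 1)) (Fin (d + 1)) R :=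
    A.submatrix (Fin.cons l id : Fin (d + 1) → Fin d) id
  have hB : B.det = 0 := det_zero_of_row_eq (i := 0) (j := l.succ) (Fin.succ_ne_zero l).symm
    (by ext; simp [B])
  rw [← hB, det_succ_row_zero]
  refine Finset.sum_congr rfl fun j _ => ?_
  have : B.submatrix Fin.succ j.succAbove = A.submatrix id j.succAbove := by
    ext; simp [B]
  rw [this]
  simp [B]
  ring

variable {k : Type*} [Field k] {d : ℕ}

lemma mulVec_eq_submatrix_mulVec (A : Matrix (Fin d) (Fin (d + 1)) k) (j : Fin (d + 1))
    {b : Fin (d + 1) → k} (hj : b j = 0) :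
    A *ᵥ b = A.submatrix id j.succAbove *ᵥ (b ∘ j.succAbove) := by
  ext l
  simp [mulVec, dotProduct, Fin.sum_univ_succAbove _ j, hj]

lemma eq_zero_of_comp_succAbove {j : Fin (d + 1)} {b : Fin (d + 1) → k} (hj : b j = 0)
    (h : b ∘ j.succAbove = 0) : b = 0 := by
  ext m
  rcases Fin.eq_self_or_eq_succAbove j m with rfl | ⟨m, rfl⟩
  · exact hj
  · exact congrFun h m

lemma eq_zero_of_mulVec_eq_zero_of_minor_ne_zero {A : Matrix (Fin d) (Fin (d + 1)) k}
    {j : Fin (d + 1)} (hA : (A.submatrix id j.succAbove).det ≠ 0) {b : Fin (d + 1) → k}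
    (hb : A *ᵥ b = 0) (hj : b j = 0) : b = 0 :=
  eq_zero_of_comp_succAbove hj
    (eq_zero_of_mulVec_eq_zero hA (mulVec_eq_submatrix_mulVec A j hj ▸ hb))

/-- If deleting one column leaves a square matrix with nonzero adjugate, that is, of corank at most
one, then the kernel is at most two-dimensional: a kernel vector is determined by two entries. -/
lemma finrank_ker_mulVecLin_le_two (A : Matrix (Fin d) (Fin (d + 1)) k) (j : Fin (d + 1))
    (hA : (A.submatrix id j.succAbove).adjugate ≠ 0) :
    Module.finrank k (LinearMap.ker A.mulVecLin) ≤ 2 := by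
  obtain ⟨i, m, him⟩ : ∃ i m, (A.submatrix id j.succAbove).adjugate i m ≠ 0 := by
    by_contra! h
    exact hA (Matrix.ext h)
  rw [adjugate_apply] at him
  let entries : (Fin (d + 1) → k) →ₗ[k] k × k :=
    (LinearMap.proj j).prod (LinearMap.proj (j.succAbove i))
  have hinj : Function.Injective (entries ∘ₗ (LinearMap.ker A.mulVecLin).subtype) := by
    rw [← LinearMap.ker_eq_bot, LinearMap.ker_eq_bot']
    rintro ⟨b, hb⟩ h
    obtain ⟨hj, hi⟩ : b j = 0 ∧ b (j.succAbove i) = 0 := by simpa [entries] using h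
    rw [LinearMap.mem_ker, mulVecLin_apply, mulVec_eq_submatrix_mulVec A j hj] at hb
    refine Subtype.ext (eq_zero_of_comp_succAbove hj (eq_zero_of_mulVec_eq_zero him ?_))
    ext l
    by_cases hl : l = m
    · subst hl
      simp [mulVec, hi]
    · simpa [mulVec, updateRow_ne hl] using congrFun hb l
  simpa using LinearMap.finrank_le_finrank_of_injective hinj

/-- If `det B = t g` and the adjugate of `B(0)` vanishes, then `g(0) = 0`: a determinant vanishes to
order two where the matrix has corank at least two. -/
lemma eval_zero_eq_zero_of_adjugate_eq_zero (B : Matrix (Fin d) (Fin d) (Polynomial k))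
    {g : Polynomial k} (hB : B.det = Polynomial.X * g)
    (hadj : (B.map (Polynomial.eval 0)).adjugate = 0) : g.eval 0 = 0 := by
  have hmap : B.map (Polynomial.eval 0) = (Polynomial.evalRingHom (0 : k)).mapMatrix B := rfl
  have hX : ∀ i j, ∃ N, B.adjugate i j = Polynomial.X * N := fun i j => by
    refine Polynomial.X_dvd_iff.mpr ?_
    rw [hmap, ← RingHom.map_adjugate] at hadj
    rw [Polynomial.coeff_zero_eq_eval_zero]
    exact congrFun (congrFun hadj i) j
  choose N hN using hX
  have hadjN : B.adjugate = (Polynomial.X : Polynomial k) • Matrix.of N := by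
    ext1 i j; simp [hN]
  -- Cancelling `t` in `B * adj B = det B` exhibits `g` as `B * N`.
  have hBN : B * Matrix.of N = g • 1 := by
    have := B.mul_adjugate
    rw [hadjN, hB, Matrix.mul_smul, mul_smul] at this
    exact smul_right_injective _ Polynomial.X_ne_zero this
  by_contra hg
  have hdet := congrArg (fun M => Polynomial.eval 0 M.det) hBN
  simp only [det_mul, hB, det_smul, det_one, mul_one, Polynomial.eval_mul, Polynomial.eval_X,
    zero_mul, Polynomial.eval_pow] at hdet
  exact pow_ne_zero _ hg hdet.symm

end Minors

/-! ### The Hilbert-Burch matrix at a point -/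

section HilbertBurch

open Matrix

variable {k : Type*} [Field k] {d : ℕ} {L : Matrix (Fin d) (Fin (d + 1)) (MvPolynomial (Fin 3) k)}

/-- The matrix of scalars `L(w)`. -/
noncomputable def evalMatrix (L : Matrix (Fin d) (Fin (d + 1)) (MvPolynomial (Fin 3) k))
    (w : Fin 3 → k) : Matrix (Fin d) (Fin (d + 1)) k :=
  L.map (eval w)

lemma eval_signedMinor (w : Fin 3 → k) (j : Fin (d + 1)) :
    eval w (signedMinor L j)
      = (-1) ^ (j : ℕ) * ((evalMatrix L w).submatrix id j.succAbove).det := by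
  rw [signedMinor, map_mul, RingHom.map_det]
  simp [evalMatrix, submatrix_map]

lemma sum_mul_signedMinor (l : Fin d) : ∑ j, L l j * signedMinor L j = 0 :=
  sum_mul_det_submatrix_succAbove L l

lemma evalMatrix_mulVec_signedMinor (w : Fin 3 → k) :
    evalMatrix L w *ᵥ (fun j => eval w (signedMinor L j)) = 0 := by
  ext l
  simpa [evalMatrix, mulVec, dotProduct] using congrArg (eval w) (sum_mul_signedMinor (L := L) l)

/-- Where some maximal minor is nonzero, the minors span the kernel. -/
lemma exists_eq_smul_of_mulVec_eq_zero {w : Fin 3 → k} {j : Fin (d + 1)}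
    (hj : eval w (signedMinor L j) ≠ 0) {b : Fin (d + 1) → k} (hb : evalMatrix L w *ᵥ b = 0) :
    ∃ c : k, b = c • fun j => eval w (signedMinor L j) := by
  have hdet : ((evalMatrix L w).submatrix id j.succAbove).det ≠ 0 := by
    rw [eval_signedMinor] at hj
    exact right_ne_zero_of_mul hj
  refine ⟨b j / eval w (signedMinor L j), sub_eq_zero.mp ?_⟩
  refine eq_zero_of_mulVec_eq_zero_of_minor_ne_zero hdet ?_ ?_
  · rw [mulVec_sub, mulVec_smul, hb, evalMatrix_mulVec_signedMinor, smul_zero, sub_zero]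
  · simp [hj]

/-- The differential at `w` of `(F_1, …, F_{d+1})`. -/
noncomputable def minorsDeriv (L : Matrix (Fin d) (Fin (d + 1)) (MvPolynomial (Fin 3) k))
    (w : Fin 3 → k) : (Fin 3 → k) →ₗ[k] (Fin (d + 1) → k) :=
  LinearMap.pi fun j => dirDeriv w (signedMinor L j)

@[simp]
lemma minorsDeriv_apply (w v : Fin 3 → k) (j : Fin (d + 1)) :
    minorsDeriv L w v j = dirDeriv w (signedMinor L j) v := rfl

/-- Differentiating the relation `L F = 0` at a common zero of the `F_j`. -/
lemma evalMatrix_mulVec_minorsDeriv {w : Fin 3 → k} (hF : ∀ j, eval w (signedMinor L j) = 0)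
    (v : Fin 3 → k) : evalMatrix L w *ᵥ minorsDeriv L w v = 0 := by
  ext l
  choose g hg hg0 using fun j => exists_restrictLine_eq_X_mul v (hF j)
  have h := congrArg (restrictLine w v) (sum_mul_signedMinor (L := L) l)
  simp only [map_sum, map_mul, map_zero, hg, mul_left_comm _ Polynomial.X] at h
  rw [← Finset.mul_sum, mul_eq_zero, or_iff_right Polynomial.X_ne_zero] at h
  simpa [Polynomial.eval_finsetSum, eval_restrictLine, hg0, evalMatrix, mulVec, dotProduct]
    using congrArg (Polynomial.eval 0) h

/-- A maximal minor whose differential is nonzero at a common zero of all of them comes from a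
submatrix of corank one there. -/
lemma finrank_ker_evalMatrix_le_two {w : Fin 3 → k} (hF : ∀ j, eval w (signedMinor L j) = 0)
    (hD : minorsDeriv L w ≠ 0) :
    Module.finrank k (LinearMap.ker (evalMatrix L w).mulVecLin) ≤ 2 := by
  obtain ⟨v, j, hvj⟩ : ∃ v j, minorsDeriv L w v j ≠ 0 := by
    by_contra! h
    exact hD (LinearMap.ext fun v => funext (h v))
  refine finrank_ker_mulVecLin_le_two _ j fun hadj => hvj ?_
  obtain ⟨g, hg, hg0⟩ := exists_restrictLine_eq_X_mul v (hF j)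
  let B := (L.submatrix id j.succAbove).map (restrictLine w v)
  have hB : B.det = Polynomial.X * ((-1) ^ (j : ℕ) * g) := by
    have h : restrictLine w v (signedMinor L j) = (-1) ^ (j : ℕ) * B.det := by
      rw [signedMinor, map_mul, AlgHom.map_det]
      simp [B]
    rw [mul_left_comm, ← hg, h, ← mul_assoc, ← mul_pow]
    simp
  have hB0 : B.map (Polynomial.eval 0) = (evalMatrix L w).submatrix id j.succAbove := by
    ext
    simp [B, eval_restrictLine, evalMatrix]
  have := eval_zero_eq_zero_of_adjugate_eq_zero B hB (by rw [hB0, hadj])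
  rw [minorsDeriv_apply, ← hg0]
  simpa using this

variable {X : Finset (Projectivization k (Fin 3 → k))}

lemma signedMinor_mem_vanishingIdeal
    (hL : IsHilbertBurch (X : Set (Projectivization k (Fin 3 → k))) L) (j : Fin (d + 1)) :
    signedMinor L j ∈ vanishingIdeal (X : Set (Projectivization k (Fin 3 → k))) :=
  hL.2 ▸ Ideal.subset_span ⟨j, rfl⟩

lemma eval_signedMinor_eq_zero_of_mem
    (hL : IsHilbertBurch (X : Set (Projectivization k (Fin 3 → k))) L) {w : Fin 3 → k}
    (hw : w ≠ 0) (hwX : Projectivization.mk k w hw ∈ X) (j : Fin (d + 1)) :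
    eval w (signedMinor L j) = 0 :=
  signedMinor_mem_vanishingIdeal hL j _ hwX w hw rfl

lemma exists_eval_signedMinor_ne_zero
    (hL : IsHilbertBurch (X : Set (Projectivization k (Fin 3 → k))) L) {w : Fin 3 → k}
    (hw : w ≠ 0) (hwX : Projectivization.mk k w hw ∉ X) :
    ∃ j, eval w (signedMinor L j) ≠ 0 := by
  obtain ⟨f, hf, hfw⟩ := exists_mem_vanishingIdeal_eval_ne_zero X hw hwX
  rw [hL.2, Ideal.mem_span_range_iff_exists_fun] at hf
  obtain ⟨c, rfl⟩ := hf
  by_contra! h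
  exact hfw (by simp [h])

/-- The differential of a function in `I_X` at a point of `X` is a combination of the differentials
of the `F_j`. -/
lemma dirDeriv_eq_zero_of_minorsDeriv_eq_zero
    (hL : IsHilbertBurch (X : Set (Projectivization k (Fin 3 → k))) L) {w v : Fin 3 → k}
    (hF : ∀ j, eval w (signedMinor L j) = 0) (hv : minorsDeriv L w v = 0)
    {f : MvPolynomial (Fin 3) k}
    (hf : f ∈ vanishingIdeal (X : Set (Projectivization k (Fin 3 → k)))) :
    dirDeriv w f v = 0 := by
  rw [hL.2, Ideal.mem_span_range_iff_exists_fun] at hf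
  obtain ⟨c, rfl⟩ := hf
  have hadd : ∀ s : Finset (Fin (d + 1)),
      dirDeriv w (∑ j ∈ s, c j * signedMinor L j) v = 0 := fun s => by
    induction s using Finset.cons_induction with
    | empty => simp [dirDeriv_apply]
    | cons j s hj ih =>
      have hvj : dirDeriv w (signedMinor L j) v = 0 := congrFun hv j
      rw [Finset.sum_cons, dirDeriv_add, dirDeriv_mul, ih, hF, hvj]
      ring
  exact hadd _

/-- At a point of the reduced scheme `X` the differentials of the elements of `I_X` have rank two:
a product of a line through `w` with a curve through the other points of `X` that avoids `w` lies
in `I_X`, and its differential at `w` is a multiple of the line. -/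
lemma ker_minorsDeriv_le (hL : IsHilbertBurch (X : Set (Projectivization k (Fin 3 → k))) L)
    {w : Fin 3 → k} (hw : w ≠ 0) (hwX : Projectivization.mk k w hw ∈ X) :
    LinearMap.ker (minorsDeriv L w) ≤ Submodule.span k {w} := by
  classical
  intro v hv
  rw [LinearMap.mem_ker] at hv
  obtain ⟨g, hg, hgw⟩ := exists_mem_vanishingIdeal_eval_ne_zero
    (X.erase (Projectivization.mk k w hw)) hw (Finset.notMem_erase _ _)
  refine mem_span_of_eval_lineThrough hw fun i j => ?_
  have hline : eval w (lineThrough w i j) = 0 := by rw [eval_lineThrough]; ring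
  have hmem : lineThrough w i j * g
      ∈ vanishingIdeal (X : Set (Projectivization k (Fin 3 → k))) := by
    intro P hP u hu huP
    rw [map_mul]
    by_cases hPw : P = Projectivization.mk k w hw
    · subst hPw
      rw [(vanishesAt_mk_iff (isHomogeneous_lineThrough w i j) hw).mpr hline u hu huP, zero_mul]
    · rw [hg P (Finset.mem_coe.mpr (Finset.mem_erase.mpr ⟨hPw, hP⟩)) u hu huP, mul_zero]
  have h := dirDeriv_eq_zero_of_minorsDeriv_eq_zero hL
    (eval_signedMinor_eq_zero_of_mem hL hw hwX) hv hmem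
  rw [dirDeriv_mul, hline, zero_mul, zero_add, dirDeriv_lineThrough] at h
  exact (mul_eq_zero.mp h).resolve_right hgw

/-- Over a point of `X` every kernel vector of `L(w)` is a directional derivative of the `F_j`:
the exceptional curve is the image of the tangent directions. -/
lemma exists_minorsDeriv_eq (hL : IsHilbertBurch (X : Set (Projectivization k (Fin 3 → k))) L)
    {w : Fin 3 → k} (hw : w ≠ 0) (hwX : Projectivization.mk k w hw ∈ X) {b : Fin (d + 1) → k}
    (hb : evalMatrix L w *ᵥ b = 0) : ∃ v, minorsDeriv L w v = b := by
  have hF := eval_signedMinor_eq_zero_of_mem hL hw hwX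
  have hker : Module.finrank k (LinearMap.ker (minorsDeriv L w)) ≤ 1 :=
    (Submodule.finrank_mono (ker_minorsDeriv_le hL hw hwX)).trans (finrank_span_singleton hw).le
  have hrank := (minorsDeriv L w).finrank_range_add_finrank_ker
  rw [Module.finrank_fin_fun] at hrank
  have hD : minorsDeriv L w ≠ 0 := by
    intro h
    rw [h, LinearMap.range_zero, finrank_bot, ← h] at hrank
    omega
  have hle : LinearMap.range (minorsDeriv L w) ≤ LinearMap.ker (evalMatrix L w).mulVecLin := by
    rintro _ ⟨v, rfl⟩
    exact evalMatrix_mulVec_minorsDeriv hF v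
  have htwo := finrank_ker_evalMatrix_le_two hF hD
  have heq := Submodule.eq_of_le_of_finrank_le hle (by omega)
  have hmem : b ∈ LinearMap.ker (evalMatrix L w).mulVecLin := hb
  rwa [← heq] at hmem

end HilbertBurch

/-! ### Segre-Veronese coordinates -/

section SegreVeronese

variable {k : Type*} [Field k] {n d : ℕ}

/-- The vector `(w^α b_j)`, over any commutative ring. -/
noncomputable def segreVeronese {R : Type*} [CommRing R] (n : ℕ) (w : Fin 3 → R)
    (b : Fin (d + 1) → R) : Idx n d → R :=
  fun a => (∏ i, w i ^ a.1.1 i) * b a.2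

lemma phiCoord_eq_segreVeronese (L : Matrix (Fin d) (Fin (d + 1)) (MvPolynomial (Fin 3) k))
    (w : Fin 3 → k) :
    phiCoord n L w = segreVeronese n w fun j => eval w (signedMinor L j) := by
  ext a
  simp [phiCoord, segreVeronese, eval_monomial, Finsupp.prod_fintype]

lemma segreVeronese_smul {R : Type*} [CommRing R] (w : Fin 3 → R) (c : R) (b : Fin (d + 1) → R) :
    segreVeronese n w (c • b) = c • segreVeronese n w b := by
  ext a
  simp [segreVeronese]
  ring

lemma segreVeronese_ne_zero {w : Fin 3 → k} {b : Fin (d + 1) → k} (hw : w ≠ 0) (hb : b ≠ 0) :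
    segreVeronese n w b ≠ 0 := by
  obtain ⟨i, hi⟩ := Function.ne_iff.mp hw
  obtain ⟨j, hj⟩ := Function.ne_iff.mp hb
  refine Function.ne_iff.mpr ⟨(⟨Finsupp.single i n, Finsupp.degree_single i n⟩, j), ?_⟩
  have : ∏ m, w m ^ (Finsupp.single i n) m = w i ^ n := by
    rw [Finset.prod_eq_single i] <;> simp +contextual [eq_comm]
  simpa [segreVeronese, this] using ⟨fun h => absurd h hi, hj⟩

lemma prod_pow_add_single (w : Fin 3 → k) (γ : Fin 3 →₀ ℕ) (i : Fin 3) :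
    ∏ m, w m ^ (γ + Finsupp.single i 1 : Fin 3 →₀ ℕ) m = (∏ m, w m ^ γ m) * w i := by
  simp only [Finsupp.add_apply, pow_add, Finset.prod_mul_distrib]
  congr 1
  rw [Finset.prod_eq_single i] <;> simp +contextual [eq_comm]

lemma prod_pow_up (w : Fin 3 → k) (β : MonPred n) (i : Fin 3) :
    ∏ m, w m ^ (β.up i).1 m = (∏ m, w m ^ β.1 m) * w i :=
  prod_pow_add_single w β.1 i

lemma exists_eq_add_single {γ : Fin 3 →₀ ℕ} (hγ : γ ≠ 0) :
    ∃ δ i, γ = δ + Finsupp.single i 1 := by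
  obtain ⟨i, hi⟩ := Finsupp.ne_iff.mp hγ
  exact ⟨γ - Finsupp.single i 1, i, (tsub_add_cancel_of_le
    (Finsupp.single_le_iff.mpr (Nat.one_le_iff_ne_zero.mpr hi))).symm⟩

/-- The Veronese surface is cut out by the minors of the catalecticant matrix. If the coordinate
`a_{β₀ + e_{i₀}}` is nonzero, the point is read off from the column `β₀`. -/
lemma exists_eq_veronese {a : Mon n → k} {β₀ : MonPred n} {i₀ : Fin 3} (ha : a (β₀.up i₀) ≠ 0)
    (hcat : ∀ i m (β γ : MonPred n), a (β.up i) * a (γ.up m) = a (γ.up i) * a (β.up m)) :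
    ∃ (w : Fin 3 → k) (c : k), w i₀ ≠ 0 ∧ ∀ α : Mon n, a α = c * ∏ i, w i ^ α.1 i := by
  set w : Fin 3 → k := fun i => a (β₀.up i) with hw
  have hdeg : ∀ i, (Finsupp.single i n : Fin 3 →₀ ℕ).degree = n :=
    fun i => Finsupp.degree_single i n
  -- Every factor of a monomial can be traded for `w_{i₀}`.
  have key : ∀ (r m : ℕ) (γ : Fin 3 →₀ ℕ) (_ : γ.degree = r)
      (h : (γ + Finsupp.single i₀ m).degree = n),
      a ⟨_, h⟩ * w i₀ ^ r = (∏ i, w i ^ γ i) * a ⟨_, hdeg i₀⟩ := by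
    intro r
    induction r with
    | zero =>
      intro m γ hγ h
      obtain rfl := (Finsupp.degree_eq_zero_iff γ).mp hγ
      obtain rfl : m = n := by simpa using h
      simp
    | succ r ih =>
      intro m γ hγ h
      obtain ⟨δ, i, rfl⟩ := exists_eq_add_single (γ := γ) (by rintro rfl; simp at hγ)
      have hδ : δ.degree = r := by simpa using hγ
      have hdn : r + 1 + m = n := by simpa [hδ] using h
      let β : MonPred n := ⟨δ + Finsupp.single i₀ m, by simp [hδ]; omega⟩
      have e1 : (⟨_, h⟩ : Mon n) = β.up i := Subtype.ext (add_right_comm _ _ _)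
      have h' : (δ + Finsupp.single i₀ (m + 1)).degree = n := by simp [hδ]; omega
      have e2 : (⟨_, h'⟩ : Mon n) = β.up i₀ := Subtype.ext (by
        simp [β, MonPred.up, Finsupp.single_add, add_assoc])
      have hstep := ih (m + 1) δ hδ h'
      rw [e2] at hstep
      rw [e1, prod_pow_add_single, mul_right_comm, ← hstep]
      have := hcat i i₀ β β₀
      simp only [hw] at this ⊢
      linear_combination (a (β₀.up i₀)) ^ r * this
  refine ⟨w, a ⟨_, hdeg i₀⟩ / w i₀ ^ n, ha, fun α => ?_⟩
  have h := key n 0 α.1 α.2 (by simpa using α.2)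
  simp only [Finsupp.single_zero, add_zero, Subtype.coe_eta] at h
  have hne : w i₀ ^ n ≠ 0 := pow_ne_zero _ ha
  field_simp
  linear_combination h

end SegreVeronese

/-! ### The algebraic set as an incidence variety -/

section Incidence

open Matrix

variable {k : Type*} [Field k] {n d : ℕ}
  {L : Matrix (Fin d) (Fin (d + 1)) (MvPolynomial (Fin 3) k)}

/-- The equations of `algSetV`. -/
def equations (n : ℕ) (L : Matrix (Fin d) (Fin (d + 1)) (MvPolynomial (Fin 3) k)) :
    Set (MvPolynomial (Idx n d) k) :=
  linearRelations n L ∪ twoMinors (coordMatrix k n d) ∪ ⋃ j, twoMinors (catalecticant k n d j)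

lemma isHomogeneous_of_mem_equations {f : MvPolynomial (Idx n d) k} (hf : f ∈ equations n L) :
    ∃ e, f.IsHomogeneous e := by
  have hX : ∀ a b a' b' : Idx n d,
      (X a * X b - X a' * X b' : MvPolynomial (Idx n d) k).IsHomogeneous 2 := fun a b a' b' =>
    ((isHomogeneous_X k a).mul (isHomogeneous_X k b)).sub
      ((isHomogeneous_X k a').mul (isHomogeneous_X k b'))
  rcases hf with (⟨l, β, rfl⟩ | ⟨α, β, i, j, rfl⟩) | hf
  · exact ⟨1, IsHomogeneous.sum _ _ _ fun j _ => IsHomogeneous.sum _ _ _ fun i _ =>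
      isHomogeneous_C_mul_X _ _⟩
  · exact ⟨2, hX _ _ _ _⟩
  · obtain ⟨j, α, β, i, m, rfl⟩ := Set.mem_iUnion.mp hf
    exact ⟨2, hX _ _ _ _⟩

lemma isZariskiClosed_algSetV : IsZariskiClosed (algSetV n L) :=
  ⟨equations n L, fun _ => isHomogeneous_of_mem_equations, rfl⟩

lemma mk_mem_algSetV_iff {x : Idx n d → k} (hx : x ≠ 0) :
    Projectivization.mk k x hx ∈ algSetV n L ↔ ∀ f ∈ equations n L, eval x f = 0 := by
  refine forall₂_congr fun f hf => ?_
  obtain ⟨e, he⟩ := isHomogeneous_of_mem_equations hf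
  exact vanishesAt_mk_iff he hx

lemma eval_linearRelation_segreVeronese (hL : ∀ l j, (L l j).IsHomogeneous 1) (l : Fin d)
    (β : MonPred n) (w : Fin 3 → k) (b : Fin (d + 1) → k) :
    eval (segreVeronese n w b) (∑ j : Fin (d + 1), ∑ i : Fin 3,
      C ((L l j).coeff (Finsupp.single i 1)) * X (β.up i, j))
      = (∏ i, w i ^ β.1 i) * (evalMatrix L w *ᵥ b) l := by
  simp only [map_sum, map_mul, eval_C, eval_X, segreVeronese, prod_pow_up, mulVec, dotProduct,
    evalMatrix, map_apply, eval_eq_sum_coeff_of_isHomogeneous_one (hL l _), Finset.mul_sum,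
    Finset.sum_mul]
  exact Finset.sum_congr rfl fun j _ => Finset.sum_congr rfl fun i _ => by ring

lemma eval_equations_segreVeronese (hL : ∀ l j, (L l j).IsHomogeneous 1) {w : Fin 3 → k}
    {b : Fin (d + 1) → k} (hb : evalMatrix L w *ᵥ b = 0) {f : MvPolynomial (Idx n d) k}
    (hf : f ∈ equations n L) : eval (segreVeronese n w b) f = 0 := by
  rcases hf with (⟨l, β, rfl⟩ | ⟨α, β, i, j, rfl⟩) | hf
  · rw [eval_linearRelation_segreVeronese hL, hb, Pi.zero_apply, mul_zero]
  · simp only [coordMatrix, of_apply, map_sub, map_mul, eval_X, segreVeronese]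
    ring
  · obtain ⟨j, i, m, β, γ, rfl⟩ := Set.mem_iUnion.mp hf
    simp only [catalecticant, coordMatrix, of_apply, map_sub, map_mul, eval_X, segreVeronese,
      prod_pow_up]
    ring

/-- The points of `algSetV` are the Segre-Veronese images of the pairs `(w, b)` with
`L(w) b = 0`. -/
lemma exists_eq_segreVeronese (hn : 1 ≤ n) (hL : ∀ l j, (L l j).IsHomogeneous 1)
    {x : Idx n d → k} (hx : x ≠ 0) (h : ∀ f ∈ equations n L, eval x f = 0) :
    ∃ w b, w ≠ 0 ∧ evalMatrix L w *ᵥ b = 0 ∧ x = segreVeronese n w b := by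
  obtain ⟨⟨α₀, j₀⟩, hx₀⟩ := Function.ne_iff.mp hx
  rw [Pi.zero_apply] at hx₀
  have hM : ∀ α j, x (α, j) * x (α₀, j₀) = x (α, j₀) * x (α₀, j) := fun α j => by
    have := h _ (Or.inl (Or.inr ⟨α, α₀, j, j₀, rfl⟩))
    simpa [coordMatrix, sub_eq_zero] using this
  have hcat : ∀ i m (β γ : MonPred n),
      x (β.up i, j₀) * x (γ.up m, j₀) = x (γ.up i, j₀) * x (β.up m, j₀) := fun i m β γ => by
    have := h _ (Or.inr (Set.mem_iUnion.mpr ⟨j₀, i, m, β, γ, rfl⟩))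
    simpa [catalecticant, coordMatrix, sub_eq_zero] using this
  obtain ⟨β₀, i₀, rfl⟩ : ∃ (β₀ : MonPred n) (i₀ : Fin 3), α₀ = β₀.up i₀ := by
    obtain ⟨α, hα⟩ := α₀
    obtain ⟨δ, i, rfl⟩ := exists_eq_add_single (γ := α) (by
      rintro rfl
      rw [map_zero] at hα
      omega)
    exact ⟨⟨δ, by simpa using hα⟩, i, rfl⟩
  obtain ⟨w, c, hw, hwc⟩ := exists_eq_veronese (a := fun α => x (α, j₀)) hx₀ hcat
  have hxw : x = segreVeronese n w fun j => c * (x (β₀.up i₀, j) / x (β₀.up i₀, j₀)) := by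
    ext ⟨α, j⟩
    rw [segreVeronese]
    have h1 := hM α j
    have h2 := hwc α
    field_simp
    rw [h1, h2]
    ring
  refine ⟨w, _, fun h0 => hw (congrFun h0 i₀), ?_, hxw⟩
  ext l
  -- The relation for `β = (n - 1) e_{i₀}` suffices, as `w^β ≠ 0`.
  let β : MonPred n := ⟨Finsupp.single i₀ (n - 1), by rw [Finsupp.degree_single]; omega⟩
  have hrel := h _ (Or.inl (Or.inl ⟨l, β, rfl⟩))
  rw [hxw, eval_linearRelation_segreVeronese hL] at hrel
  refine (mul_eq_zero.mp hrel).resolve_left (Finset.prod_ne_zero_iff.mpr fun i _ => ?_)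
  by_cases hi : i = i₀
  · subst hi
    exact pow_ne_zero _ hw
  · simp [β, Ne.symm hi]

end Incidence

/-! ### Degeneration along lines through the points of `X` -/

section Degeneration

open Matrix

variable {k : Type*} [Field k] [Infinite k] {n d : ℕ}
  {L : Matrix (Fin d) (Fin (d + 1)) (MvPolynomial (Fin 3) k)}
  {X : Finset (Projectivization k (Fin 3 → k))}

/-- A form that vanishes on the image of `φ` vanishes at `(w^α ∂_v F_j(w))`, the limit of
`φ(w + t v)` for `t → 0`. -/
lemma eval_segreVeronese_minorsDeriv
    (hL : IsHilbertBurch (X : Set (Projectivization k (Fin 3 → k))) L)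
    {w v : Fin 3 → k} (hw : w ≠ 0) (hF : ∀ j, eval w (signedMinor L j) = 0)
    (hv : minorsDeriv L w v ≠ 0) {f : MvPolynomial (Idx n d) k} {e : ℕ} (hf : f.IsHomogeneous e)
    (hfφ : ∀ Q ∈ phiImage n (X : Set (Projectivization k (Fin 3 → k))) L, VanishesAt f Q) :
    eval (segreVeronese n w (minorsDeriv L w v)) f = 0 := by
  choose g hg hg0 using fun j => exists_restrictLine_eq_X_mul v (hF j)
  obtain ⟨i, hi⟩ := Function.ne_iff.mp hw
  obtain ⟨j, hj⟩ := Function.ne_iff.mp hv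
  let W : Fin 3 → Polynomial k := fun i => Polynomial.C (w i) + Polynomial.X * Polynomial.C (v i)
  let H : Polynomial k := aeval (segreVeronese n W g) f
  have hW : ∀ t i, (W i).eval t = (w + t • v) i := fun t i => by
    simp [W, mul_comm t]
  have hgt : ∀ t j, eval (w + t • v) (signedMinor L j) = t * (g j).eval t := fun t j => by
    rw [← eval_restrictLine, hg]
    simp
  have hH : ∀ t, H.eval t = eval (segreVeronese n (w + t • v) fun j => (g j).eval t) f := by
    intro t
    have : (segreVeronese n (w + t • v) fun j => (g j).eval t)
        = fun a => Polynomial.aeval t (segreVeronese n W g a) := by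
      ext a
      simp only [segreVeronese, Polynomial.coe_aeval_eq_eval, Polynomial.eval_mul,
        Polynomial.eval_prod, Polynomial.eval_pow, hW]
    rw [this, ← aeval_eq_eval]
    exact comp_aeval_apply (segreVeronese n W g) (Polynomial.aeval t) f
  -- Away from the finitely many zeros of `P` the point `φ(w + t v)` is defined.
  let P : Polynomial k := Polynomial.X * (W i * g j)
  have hP : P ≠ 0 := by
    refine mul_ne_zero Polynomial.X_ne_zero (mul_ne_zero ?_ ?_) <;>
      refine fun h0 => ?_
    · exact hi (by simpa [W] using congrArg (Polynomial.eval 0) h0)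
    · exact hj (by simpa [hg0] using congrArg (Polynomial.eval 0) h0)
  have hPH : P * H = 0 := by
    refine Polynomial.funext fun t => ?_
    rw [Polynomial.eval_mul, Polynomial.eval_zero, mul_eq_zero, or_iff_not_imp_left]
    intro hPt
    simp only [P, Polynomial.eval_mul, Polynomial.eval_X, mul_ne_zero_iff] at hPt
    obtain ⟨ht, hWt, hgjt⟩ := hPt
    have hwt : w + t • v ≠ 0 := fun h0 => hWt ((hW t i).trans (congrFun h0 i))
    have hFt : eval (w + t • v) (signedMinor L j) ≠ 0 := by
      rw [hgt]
      exact mul_ne_zero ht hgjt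
    have hφt : phiCoord n L (w + t • v) ≠ 0 := by
      rw [phiCoord_eq_segreVeronese]
      exact segreVeronese_ne_zero hwt (Function.ne_iff.mpr ⟨j, hFt⟩)
    have h0 := hfφ _ ⟨w + t • v, hwt, hφt, fun hmem =>
      hFt (eval_signedMinor_eq_zero_of_mem hL hwt hmem j), rfl⟩ _ hφt rfl
    have hφ : phiCoord n L (w + t • v)
        = t • segreVeronese n (w + t • v) fun j => (g j).eval t := by
      rw [phiCoord_eq_segreVeronese, ← segreVeronese_smul]
      congr 1
      ext j
      simp [hgt]
    rw [hφ, eval_smul_of_isHomogeneous hf, ← hH] at h0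
    exact (mul_eq_zero.mp h0).resolve_left (pow_ne_zero _ ht)
  have hH0 := congrArg (Polynomial.eval 0) ((mul_eq_zero.mp hPH).resolve_left hP)
  rw [hH, Polynomial.eval_zero, zero_smul, add_zero] at hH0
  rwa [funext hg0] at hH0

lemma algSetV_subset_embeddedBlowup (hn : 1 ≤ n)
    (hL : IsHilbertBurch (X : Set (Projectivization k (Fin 3 → k))) L) :
    algSetV n L ⊆ embeddedBlowup n (X : Set (Projectivization k (Fin 3 → k))) L := by
  rintro Q hQ Z ⟨⟨S, hS, rfl⟩, hZ⟩
  induction Q using Projectivization.ind with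
  | h x hx =>
    obtain ⟨w, b, hw, hb, rfl⟩ :=
      exists_eq_segreVeronese hn hL.1 hx ((mk_mem_algSetV_iff hx).mp hQ)
    by_cases hwX : Projectivization.mk k w hw ∈ X
    · obtain ⟨v, rfl⟩ := exists_minorsDeriv_eq hL hw hwX hb
      intro f hf
      obtain ⟨e, he⟩ := hS f hf
      refine (vanishesAt_mk_iff he hx).mpr (eval_segreVeronese_minorsDeriv hL hw
        (eval_signedMinor_eq_zero_of_mem hL hw hwX) ?_ he fun Q hQ => hZ hQ f hf)
      intro h0
      exact hx (funext fun a => by rw [segreVeronese, h0, Pi.zero_apply, mul_zero, Pi.zero_apply])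
    · obtain ⟨j, hj⟩ := exists_eval_signedMinor_ne_zero hL hw hwX
      obtain ⟨c, rfl⟩ := exists_eq_smul_of_mulVec_eq_zero hj hb
      have hφ : phiCoord n L w ≠ 0 := by
        rw [phiCoord_eq_segreVeronese]
        exact segreVeronese_ne_zero hw (Function.ne_iff.mpr ⟨j, hj⟩)
      refine hZ ⟨w, hw, hφ, hwX, (Projectivization.mk_eq_mk_iff' ..).mpr ⟨c, ?_⟩⟩
      rw [phiCoord_eq_segreVeronese, segreVeronese_smul]

end Degeneration

lemma embeddedBlowup_subset_algSetV {k : Type*} [Field k] {n d : ℕ}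
    {L : Matrix (Fin d) (Fin (d + 1)) (MvPolynomial (Fin 3) k)}
    (hL : ∀ l j, (L l j).IsHomogeneous 1) (X : Set (Projectivization k (Fin 3 → k))) :
    embeddedBlowup n X L ⊆ algSetV n L := by
  refine Set.sInter_subset_of_mem ⟨isZariskiClosed_algSetV, ?_⟩
  rintro _ ⟨w, hw, hφ, -, rfl⟩
  refine (mk_mem_algSetV_iff hφ).mpr fun f hf => ?_
  rw [phiCoord_eq_segreVeronese]
  exact eval_equations_segreVeronese hL (evalMatrix_mulVec_signedMinor w) hf

end BoxBlowup

theorem theorem2 {k : Type*} [Field k] [IsAlgClosed k] [CharZero k]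
    (d n : ℕ) (hd : 1 ≤ d) (hn : 1 ≤ n)
    (X : Finset (Projectivization k (Fin 3 → k)))
    (hcard : X.card = (d + 1).choose 2) (hgen : BoxBlowup.InGenericPosition X)
    (L : Matrix (Fin d) (Fin (d + 1)) (MvPolynomial (Fin 3) k))
    (hL : BoxBlowup.IsHilbertBurch (X : Set (Projectivization k (Fin 3 → k))) L) :
    BoxBlowup.algSetV n L
      = BoxBlowup.embeddedBlowup n (X : Set (Projectivization k (Fin 3 → k))) L :=
  (BoxBlowup.algSetV_subset_embeddedBlowup hn hL).antisymm
    (BoxBlowup.embeddedBlowup_subset_algSetV hL.1 _)
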